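/- Let $d\ge 1$ be an integer. For a set $K\subset\mathbb{C}$ and an integer $n\ge 1$ let $$A_n(K)=\inf\Big\{m\big(\{z\in\mathbb{C}:|p(z)|<1\}\big)\;:\; p(z)=\prod_{j=1}^n (z-z_j),\ z_1,\dots,z_n\in K\Big\},\qquad \mu(K)=\inf_{n\ge 1}A_n(K),$$ where $m$ is Lebesgue measure on $\mathbb{C}$. There is a constant $C>0$, depending only on $d$, such that for every set of the form $K=Q^{-1}([-2,2])$, where $Q$ is a monic complex polynomial of degree $d$ (a period-$d$ set), one has $\mu(K)=0$ and $$A_{nd}(K)\le C\,n^{-1/d}\qquad\text{for all integers } n\ge 1.$$ -/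

import Mathlib

open Polynomial MeasureTheory
open scoped ENNReal

/-- The unit lemniscate `Λ_p = {z : |p(z)| < 1}` of a complex polynomial. -/
def unitLemniscate (p : ℂ[X]) : Set ℂ := {z | ‖p.eval z‖ < 1}

/-- The set `𝒫_n(K)` of monic polynomials `∏_{j=1}^n (z - z_j)` with all `z_j ∈ K`. -/
def monicWithZerosIn (n : ℕ) (K : Set ℂ) : Set ℂ[X] :=
  {p | ∃ z : Fin n → ℂ, (∀ j, z j ∈ K) ∧ p = ∏ j, (X - C (z j))}

/-- `A_n(K)`, the infimum of the areas of the lemniscates of the members of `𝒫_n(K)`, as an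
extended nonnegative real. -/
noncomputable def minLemniscateArea (n : ℕ) (K : Set ℂ) : ℝ≥0∞ :=
  ⨅ p ∈ monicWithZerosIn n K, volume (unitLemniscate p)

/-- `μ(K) = inf_n A_n(K)` over the positive integers `n` (the constant polynomial `1`, whose
lemniscate is empty, does not take part). -/
noncomputable def infLemniscateArea (K : Set ℂ) : ℝ≥0∞ :=
  ⨅ (n : ℕ) (_ : 1 ≤ n), minLemniscateArea n K

/-- The real segment `[-2, 2]` as a subset of the complex plane. -/
def segmentTwo : Set ℂ := (fun x : ℝ => (x : ℂ)) '' Set.Icc (-2) 2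

/-- `K` is a period-`d` set: `K = Q⁻¹([-2, 2])` for a monic complex polynomial `Q` of degree `d`.
For `d ≥ 1` such a set is automatically compact, and of logarithmic capacity `1`, so neither is
listed as a condition. -/
def IsPeriodSet (d : ℕ) (K : Set ℂ) : Prop :=
  ∃ Q : ℂ[X], Q.Monic ∧ Q.natDegree = d ∧ K = (fun z => Q.eval z) ⁻¹' segmentTwo

/-!
For a period-`d` set `K = Q⁻¹([-2, 2])`, small lemniscates are those of `Cₙ ∘ Q`, where `Cₙ` is the
monic Chebyshev polynomial `Cₙ(w + w⁻¹) = wⁿ + w⁻ⁿ`. The zeros of `Cₙ` lie in `[-2, 2]`, so those of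
`Cₙ ∘ Q` lie in `K`, and the lemniscate of `Cₙ ∘ Q` is the preimage under `Q` of that of `Cₙ`.

* If `|Cₙ(w + w⁻¹)| < 1` with `|w| ≥ 1`, then `|w| ^ n < 2`, hence `|w| ≤ 1 + 1 / n`, and `w + w⁻¹`
  is at distance at most `2 / n` from the real axis. Thus the lemniscate of `Cₙ` has area at most
  `24 / n` (`volume_unitLemniscate_chebyshevC_le`).
* For every monic `Q` of degree `d` and every measurable `E`, the preimage `Q⁻¹(E)` has area at most
  `C(d) |E| ^ (1 / d)` (`volume_preimage_eval_le`). Remove from it the discs of radius `t` about the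
  `d - 1` critical points, whose area is at most `(d - 1) π t ^ 2`. On the rest
  `|Q'| = d ∏ |z - c| ≥ d t ^ (d - 1)`, and since `Q` takes each value at most `d` times, the area
  formula bounds the area of the rest by `|E| / (d t ^ (2 (d - 1)))`. Take `t ^ (2 d) = |E|`.

The vanishing of the infimum over all degrees follows from the rate by letting `n → ∞`.
-/

/-! ### The area formula for polynomials -/

/-- The real determinant of multiplication by a complex number `a` is `‖a‖ ^ 2`. -/
lemma det_restrictScalars_toSpanSingleton (a : ℂ) :
    ((ContinuousLinearMap.toSpanSingleton ℂ a).restrictScalars ℝ).det = ‖a‖ ^ 2 := by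
  have h : (((ContinuousLinearMap.toSpanSingleton ℂ a).restrictScalars ℝ : ℂ →L[ℝ] ℂ) :
      ℂ →ₗ[ℝ] ℂ) = Algebra.lmul ℝ ℂ a := by
    ext
    all_goals simp [mul_comm]
  rw [ContinuousLinearMap.det, h, ← Complex.normSq_eq_norm_sq, ← Algebra.norm_complex_apply,
    Algebra.norm_apply]

lemma exists_nhds_injOn_eval {Q : ℂ[X]} {z : ℂ} (hz : Q.derivative.eval z ≠ 0) :
    ∃ U : Set ℂ, IsOpen U ∧ z ∈ U ∧ U.InjOn (fun w => Q.eval w) := by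
  let e := ((Q.hasStrictDerivAt z).hasStrictFDerivAt_equiv hz).toOpenPartialHomeomorph _
  exact ⟨e.source, e.open_source,
    ((Q.hasStrictDerivAt z).hasStrictFDerivAt_equiv hz).mem_toOpenPartialHomeomorph_source,
    e.injOn⟩

/-- Off the critical points of `Q`, a measurable set splits into countably many measurable pieces
on each of which `Q` is injective. -/
lemma exists_measurable_partition_injOn {Q : ℂ[X]} {G : Set ℂ} (hG : MeasurableSet G)
    (h : ∀ z ∈ G, Q.derivative.eval z ≠ 0) :
    ∃ s : ℕ → Set ℂ, (∀ k, MeasurableSet (s k)) ∧ Pairwise (Function.onFun Disjoint s) ∧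
      (∀ k, (s k).InjOn (fun w => Q.eval w)) ∧ G = ⋃ k, s k := by
  choose! U hUo hUz hUi using fun z (hz : z ∈ G) => exists_nhds_injOn_eval (h z hz)
  obtain ⟨T, hTG, hTc, hGT⟩ := TopologicalSpace.countable_cover_nhdsWithin
    (fun z hz => mem_nhdsWithin_of_mem_nhds ((hUo z hz).mem_nhds (hUz z hz)))
  rcases T.eq_empty_or_nonempty with rfl | hT
  · refine ⟨fun _ => ∅, by simp, fun i j _ => by simp [Function.onFun], by simp, ?_⟩
    simpa using hGT
  obtain ⟨c, rfl⟩ := hTc.exists_eq_range hT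
  have hc : ∀ k, c k ∈ G := fun k => hTG ⟨k, rfl⟩
  refine ⟨disjointed fun k => G ∩ U (c k), fun k => ?_, disjoint_disjointed _, fun k => ?_, ?_⟩
  · exact MeasurableSet.disjointed (fun k => hG.inter (hUo _ (hc k)).measurableSet) k
  · exact (hUi _ (hc k)).mono ((disjointed_subset _ k).trans Set.inter_subset_right)
  · rw [iUnion_disjointed, ← Set.inter_iUnion]
    refine (Set.inter_eq_left.2 ?_).symm
    simpa using hGT

/-- A form of the area formula for polynomials: values are taken at most `natDegree Q` times, and
`Q` expands areas by the factor `‖Q'‖ ^ 2`. -/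
lemma ofReal_sq_mul_volume_le {Q : ℂ[X]} (hQ : 0 < Q.natDegree) {G E : Set ℂ}
    (hG : MeasurableSet G) (hE : MeasurableSet E) {m : ℝ} (hm : 0 < m)
    (hGm : ∀ z ∈ G, m ≤ ‖Q.derivative.eval z‖) (hGE : ∀ z ∈ G, Q.eval z ∈ E) :
    ENNReal.ofReal (m ^ 2) * volume G ≤ Q.natDegree * volume E := by
  obtain ⟨s, hsm, hsd, hsi, hs⟩ := exists_measurable_partition_injOn hG
    (fun z hz h0 => by have := hGm z hz; rw [h0, norm_zero] at this; linarith)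
  have hsG : ∀ k, s k ⊆ G := fun k => hs ▸ Set.subset_iUnion s k
  have hder : ∀ k, ∀ z ∈ s k, HasFDerivWithinAt (fun w => Q.eval w)
      ((ContinuousLinearMap.toSpanSingleton ℂ (Q.derivative.eval z)).restrictScalars ℝ)
      (s k) z := fun k z _ =>
    ((Q.hasDerivAt z).hasFDerivAt.restrictScalars ℝ).hasFDerivWithinAt
  have him : ∀ k, MeasurableSet ((fun w => Q.eval w) '' s k) := fun k =>
    measurable_image_of_fderivWithin (hsm k) (hder k) (hsi k)
  have hpiece : ∀ k, ENNReal.ofReal (m ^ 2) * volume (s k) ≤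
      volume ((fun w => Q.eval w) '' s k) := fun k => by
    rw [← lintegral_abs_det_fderiv_eq_addHaar_image volume (hsm k) (hder k) (hsi k),
      ← setLIntegral_const]
    refine setLIntegral_mono' (hsm k) fun z hz => ENNReal.ofReal_le_ofReal ?_
    rw [det_restrictScalars_toSpanSingleton, abs_of_nonneg (by positivity)]
    have := hGm z (hsG k hz)
    gcongr
  have hmult : ∀ w, ∑' k, ((fun w => Q.eval w) '' s k).indicator (1 : ℂ → ℝ≥0∞) w ≤
      E.indicator (fun _ => (Q.natDegree : ℝ≥0∞)) w := fun w => by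
    by_cases hw : w ∈ E
    · rw [Set.indicator_of_mem hw]
      refine ENNReal.tsum_le_of_sum_range_le fun N => ?_
      classical
      have hsum : ∑ k ∈ Finset.range N, ((fun w => Q.eval w) '' s k).indicator (1 : ℂ → ℝ≥0∞) w
          = ((Finset.range N).filter fun k => w ∈ (fun w => Q.eval w) '' s k).card := by
        simp [Set.indicator_apply, Finset.sum_boole]
      rw [hsum, Nat.cast_le]
      have hdeg : (Q - C w).natDegree = Q.natDegree := natDegree_sub_C
      have hne : Q - C w ≠ 0 := fun h0 => by rw [h0, natDegree_zero] at hdeg; omega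
      choose! r hr using fun k (hk : w ∈ (fun w => Q.eval w) '' s k) => hk
      calc _ ≤ (Q - C w).roots.toFinset.card := by
            refine Finset.card_le_card_of_injOn r (fun k hk => ?_) (fun i hi j hj hij => ?_)
            · have := (hr k (by simpa using (Finset.mem_filter.1 hk).2)).2
              simp only [Finset.mem_coe, Multiset.mem_toFinset, mem_roots hne, IsRoot,
                eval_sub, eval_C]
              exact sub_eq_zero.2 this
            · by_contra hne'
              have h1 := (hr i (Finset.mem_filter.1 hi).2).1
              have h2 := (hr j (Finset.mem_filter.1 hj).2).1
              rw [hij] at h1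
              exact Set.disjoint_left.1 (hsd hne') h1 h2
        _ ≤ Multiset.card (Q - C w).roots := Multiset.toFinset_card_le _
        _ ≤ Q.natDegree := hdeg ▸ card_roots' _
    · rw [Set.indicator_of_notMem hw, nonpos_iff_eq_zero, ENNReal.tsum_eq_zero]
      intro k
      refine Set.indicator_of_notMem ?_ _
      rintro ⟨z, hz, rfl⟩
      exact hw (hGE z (hsG k hz))
  calc ENNReal.ofReal (m ^ 2) * volume G
      = ∑' k, ENNReal.ofReal (m ^ 2) * volume (s k) := by
        rw [hs, measure_iUnion hsd hsm, ENNReal.tsum_mul_left]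
    _ ≤ ∑' k, volume ((fun w => Q.eval w) '' s k) := ENNReal.tsum_le_tsum hpiece
    _ = ∫⁻ w, ∑' k, ((fun w => Q.eval w) '' s k).indicator (1 : ℂ → ℝ≥0∞) w := by
        rw [lintegral_tsum fun k => (measurable_one.indicator (him k)).aemeasurable]
        exact tsum_congr fun k => (lintegral_indicator_one (him k)).symm
    _ ≤ ∫⁻ w, E.indicator (fun _ => (Q.natDegree : ℝ≥0∞)) w := lintegral_mono hmult
    _ = Q.natDegree * volume E := lintegral_indicator_const hE _

/-! ### Preimages under monic polynomials -/

/-- Away from its critical points, the derivative of a monic polynomial is large. -/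
lemma le_norm_eval_derivative {Q : ℂ[X]} (hQ : Q.Monic) {t : ℝ} (ht : 0 ≤ t) {z : ℂ}
    (hz : ∀ c ∈ Q.derivative.roots, t ≤ ‖z - c‖) :
    Q.natDegree * t ^ (Q.natDegree - 1) ≤ ‖Q.derivative.eval z‖ := by
  rcases Nat.eq_zero_or_pos Q.natDegree with h0 | hpos
  · simp [h0]
  have hdeg : Q.derivative.natDegree = Q.natDegree - 1 := natDegree_derivative Q
  have hlead : Q.derivative.leadingCoeff = Q.natDegree := by
    rw [leadingCoeff, hdeg, coeff_derivative, Nat.sub_add_cancel hpos, hQ.coeff_natDegree,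
      ← Nat.cast_add_one, Nat.sub_add_cancel hpos, one_mul]
  have hsp := IsAlgClosed.splits Q.derivative
  rw [hsp.eval_eq_prod_roots, hlead, norm_mul, Complex.norm_natCast, ← hdeg,
    hsp.natDegree_eq_card_roots]
  gcongr
  clear hsp hdeg hlead
  revert hz
  generalize Q.derivative.roots = R
  intro hz
  induction R using Multiset.induction_on with
  | empty => simp
  | cons c R ih =>
    rw [Multiset.card_cons, pow_succ', Multiset.map_cons, Multiset.prod_cons, norm_mul]
    exact mul_le_mul (hz c (Multiset.mem_cons_self c R))
      (ih fun c' hc' => hz c' (Multiset.mem_cons_of_mem hc')) (by positivity) (norm_nonneg _)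

/-- The preimage of a set of area at most `t ^ (2 d)` under a monic polynomial of degree `d` has
area `O(t ^ 2)`: the discs of radius `t` about the critical points have this area, and outside them
`‖Q'‖ ≥ d * t ^ (d - 1)`. -/
lemma volume_preimage_eval_le {Q : ℂ[X]} (hQ : Q.Monic) (hd : 0 < Q.natDegree) {E : Set ℂ}
    (hE : MeasurableSet E) {t : ℝ} (ht : 0 < t)
    (hEt : volume E ≤ ENNReal.ofReal (t ^ (2 * Q.natDegree))) :
    volume ((fun z => Q.eval z) ⁻¹' E) ≤
      ENNReal.ofReal ((((Q.natDegree - 1 : ℕ) : ℝ) * Real.pi + 1 / Q.natDegree) * t ^ 2) := by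
  classical
  set d := Q.natDegree with hd_def
  set F := (fun z => Q.eval z) ⁻¹' E
  set B := ⋃ c ∈ Q.derivative.roots.toFinset, Metric.ball c t
  have hF : MeasurableSet F := Q.continuous.measurable hE
  have hBm : MeasurableSet B :=
    Finset.measurableSet_biUnion _ fun c _ => Metric.isOpen_ball.measurableSet
  have hdR : (0 : ℝ) < d := by exact_mod_cast hd
  have hB : volume B ≤ ENNReal.ofReal (((d - 1 : ℕ) : ℝ) * Real.pi * t ^ 2) := by
    calc volume B ≤ ∑ c ∈ Q.derivative.roots.toFinset, volume (Metric.ball c t) :=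
          measure_biUnion_finset_le _ _
      _ = Q.derivative.roots.toFinset.card * ENNReal.ofReal (Real.pi * t ^ 2) := by
          simp only [Complex.volume_ball, Finset.sum_const, nsmul_eq_mul]
          rw [ENNReal.ofReal_mul Real.pi_pos.le, ENNReal.ofReal_pow ht.le, mul_comm (_ ^ 2),
            ← NNReal.coe_real_pi, ENNReal.ofReal_coe_nnreal]
      _ ≤ (d - 1 : ℕ) * ENNReal.ofReal (Real.pi * t ^ 2) := by
          gcongr
          exact (Multiset.toFinset_card_le _).trans
            ((card_roots' _).trans (natDegree_derivative_le Q))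
      _ = _ := by
          rw [mul_assoc, ENNReal.ofReal_mul (Nat.cast_nonneg _), ENNReal.ofReal_natCast]
  have hm : 0 < d * t ^ (d - 1) := by positivity
  have hFB : volume (F \ B) ≤ ENNReal.ofReal (1 / d * t ^ 2) := by
    have h1 := ofReal_sq_mul_volume_le (Q := Q) hd (hF.diff hBm) hE hm
      (fun z hz => le_norm_eval_derivative hQ ht.le fun c hc => by
        by_contra! hlt
        exact hz.2 (Set.mem_biUnion (by simpa using hc) (by simpa [dist_eq_norm] using hlt)))
      (fun z hz => hz.1)
    have h2 : ENNReal.ofReal ((d * t ^ (d - 1)) ^ 2) * volume (F \ B) ≤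
        ENNReal.ofReal ((d * t ^ (d - 1)) ^ 2) * ENNReal.ofReal (1 / d * t ^ 2) := by
      refine h1.trans ((mul_le_mul_right hEt _).trans (le_of_eq ?_))
      rw [← hd_def, ← ENNReal.ofReal_natCast, ← ENNReal.ofReal_mul hdR.le,
        ← ENNReal.ofReal_mul (by positivity)]
      congr 1
      obtain ⟨k, hk⟩ : ∃ k, d = k + 1 := ⟨d - 1, by omega⟩
      have hdR' := hdR.ne'
      rw [hk] at hdR' ⊢
      simp only [Nat.add_sub_cancel]
      field_simp
      ring
    exact (ENNReal.mul_le_mul_iff_right (ENNReal.ofReal_pos.2 (pow_pos hm 2)).ne' ENNReal.ofReal_ne_top).1 h2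
  calc volume F ≤ volume (B ∪ F \ B) := measure_mono fun z hz => by
        by_cases hzB : z ∈ B
        · exact Or.inl hzB
        · exact Or.inr ⟨hz, hzB⟩
    _ ≤ volume B + volume (F \ B) := measure_union_le _ _
    _ ≤ _ := add_le_add hB hFB
    _ = _ := by rw [← ENNReal.ofReal_add (by positivity) (by positivity), add_mul]

/-! ### Chebyshev polynomials and their lemniscates -/

lemma monic_natDegree_chebyshevC (n : ℕ) :
    (Chebyshev.C ℂ (n + 1 : ℕ)).Monic ∧ (Chebyshev.C ℂ (n + 1 : ℕ)).natDegree = n + 1 := by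
  induction n using Nat.twoStepInduction with
  | zero => simp [monic_X]
  | one =>
    have : Chebyshev.C ℂ ((1 + 1 : ℕ) : ℤ) = X ^ 2 - C 2 := Chebyshev.C_two ℂ
    rw [this]
    exact ⟨monic_X_pow_sub_C 2 (by norm_num), natDegree_X_pow_sub_C⟩
  | more n ih1 ih2 =>
    have h : Chebyshev.C ℂ ((n + 2 + 1 : ℕ) : ℤ) =
        X * Chebyshev.C ℂ ((n + 1 + 1 : ℕ) : ℤ) - Chebyshev.C ℂ ((n + 1 : ℕ) : ℤ) := by
      have := Chebyshev.C_add_two ℂ (n + 1 : ℕ)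
      push_cast at this ⊢
      rwa [add_right_comm (n : ℤ) 1 2] at this
    have hm : (X * Chebyshev.C ℂ ((n + 1 + 1 : ℕ) : ℤ)).Monic := monic_X.mul ih2.1
    have hdm : (X * Chebyshev.C ℂ ((n + 1 + 1 : ℕ) : ℤ)).natDegree = n + 2 + 1 := by
      rw [monic_X.natDegree_mul ih2.1, ih2.2, natDegree_X]; ring
    have hlt : (Chebyshev.C ℂ ((n + 1 : ℕ) : ℤ)).natDegree <
        (X * Chebyshev.C ℂ ((n + 1 + 1 : ℕ) : ℤ)).natDegree := by rw [hdm, ih1.2]; omega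
    rw [h]
    exact ⟨hm.sub_of_left (degree_lt_degree hlt),
      (natDegree_sub_eq_left_of_natDegree_lt hlt).trans hdm⟩

lemma eval_chebyshevC_add_inv (n : ℕ) {w : ℂ} (hw : w ≠ 0) :
    (Chebyshev.C ℂ n).eval (w + w⁻¹) = w ^ n + w⁻¹ ^ n := by
  induction n using Nat.twoStepInduction with
  | zero => simp; norm_num
  | one => simp
  | more n ih1 ih2 =>
    have h := Chebyshev.C_add_two ℂ n
    push_cast at ih2 ⊢
    rw [h, eval_sub, eval_mul, eval_X, ih1, ih2]
    have hww : w * w⁻¹ = 1 := mul_inv_cancel₀ hw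
    linear_combination (w ^ n + w⁻¹ ^ n) * hww

lemma exists_add_inv_eq (ζ : ℂ) : ∃ w : ℂ, w ≠ 0 ∧ w + w⁻¹ = ζ := by
  obtain ⟨s, hs⟩ := IsAlgClosed.exists_pow_nat_eq (ζ ^ 2 - 4) (n := 2) (by norm_num)
  have hne : (ζ + s) / 2 ≠ 0 := fun h => by
    have : s = -ζ := by linear_combination 2 * h
    rw [this] at hs
    have : (4 : ℂ) = 0 := by linear_combination hs
    norm_num at this
  refine ⟨(ζ + s) / 2, hne, ?_⟩
  have h2 : ζ + s ≠ 0 := fun h => hne (by rw [h]; simp)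
  field_simp
  linear_combination hs

lemma exists_one_le_norm_add_inv_eq (ζ : ℂ) : ∃ w : ℂ, 1 ≤ ‖w‖ ∧ w + w⁻¹ = ζ := by
  obtain ⟨w, hw, h⟩ := exists_add_inv_eq ζ
  rcases le_total 1 ‖w‖ with h1 | h1
  · exact ⟨w, h1, h⟩
  · refine ⟨w⁻¹, ?_, by rw [inv_inv, add_comm, h]⟩
    rw [norm_inv]
    exact (one_le_inv₀ (norm_pos_iff.2 hw)).2 h1

/-- All zeros of the Chebyshev polynomial lie in `[-2, 2]`: they are `w + w⁻¹` with
`w ^ (2 n) = -1`, so that `w` is on the unit circle. -/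
lemma mem_segmentTwo_of_eval_chebyshevC_eq_zero {n : ℕ} (hn : n ≠ 0) {ζ : ℂ}
    (hζ : (Chebyshev.C ℂ n).eval ζ = 0) : ζ ∈ segmentTwo := by
  obtain ⟨w, hw, rfl⟩ := exists_add_inv_eq ζ
  rw [eval_chebyshevC_add_inv n hw] at hζ
  have hpow : ‖w‖ ^ n = ‖w‖⁻¹ ^ n := by
    have := congrArg norm (eq_neg_of_add_eq_zero_left hζ)
    rwa [norm_neg, norm_pow, norm_pow, norm_inv] at this
  have hnorm : ‖w‖ = ‖w‖⁻¹ :=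
    (pow_left_inj₀ (norm_nonneg _) (by positivity) hn).1 hpow
  have h1 : ‖w‖ = 1 := by
    have hpos := norm_pos_iff.2 hw
    have : ‖w‖ * ‖w‖ = 1 := by
      nth_rewrite 2 [hnorm]
      exact mul_inv_cancel₀ hpos.ne'
    nlinarith
  refine ⟨2 * w.re, ?_, ?_⟩
  · have := abs_le.1 ((Complex.abs_re_le_norm w).trans h1.le)
    constructor <;> linarith [this.1, this.2]
  · rw [Complex.inv_eq_conj h1]
    simp [Complex.add_conj]

/-- The lemniscate of the Chebyshev polynomial of degree `n` lies in a rectangle of area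
`O(1 / n)`. -/
lemma unitLemniscate_chebyshevC_subset {n : ℕ} (hn : 1 ≤ n) :
    unitLemniscate (Chebyshev.C ℂ n) ⊆ Set.Icc (-3) 3 ×ℂ Set.Icc (-(2 / n)) (2 / n) := by
  intro ζ hζ
  obtain ⟨w, hw, rfl⟩ := exists_one_le_norm_add_inv_eq ζ
  have hw0 : w ≠ 0 := norm_pos_iff.1 (by linarith)
  have hlt : ‖w ^ n + w⁻¹ ^ n‖ < 1 := by rw [← eval_chebyshevC_add_inv n hw0]; exact hζ
  have hinv : ‖w‖⁻¹ ≤ 1 := inv_le_one_of_one_le₀ hw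
  have hpow : ‖w‖ ^ n < 2 := by
    have h1 := norm_sub_norm_le (w ^ n) (-(w⁻¹ ^ n))
    rw [sub_neg_eq_add, norm_neg, norm_pow, norm_pow, norm_inv] at h1
    have h2 : ‖w‖⁻¹ ^ n ≤ 1 := pow_le_one₀ (by positivity) hinv
    linarith
  have hnR : (0 : ℝ) < n := by exact_mod_cast hn
  have hr : ‖w‖ - 1 ≤ 1 / n := by
    -- Bernoulli's inequality
    have := one_add_mul_sub_le_pow (a := ‖w‖) (by linarith) n
    rw [le_div_iff₀ hnR]
    linarith
  have hr2 : ‖w‖ < 2 := lt_of_le_of_lt (le_self_pow₀ hw (by omega)) hpow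
  rw [Complex.mem_reProdIm]
  constructor
  · refine abs_le.1 ((Complex.abs_re_le_norm _).trans ((norm_add_le _ _).trans ?_))
    rw [norm_inv]
    linarith
  · refine abs_le.1 ?_
    have him : (w + w⁻¹).im = w.im * (1 - (‖w‖ ^ 2)⁻¹) := by
      rw [Complex.add_im, Complex.inv_im, Complex.normSq_eq_norm_sq]
      ring
    have hpos : 0 ≤ 1 - (‖w‖ ^ 2)⁻¹ := sub_nonneg.2 (inv_le_one_of_one_le₀ (one_le_pow₀ hw))
    rw [him, abs_mul, abs_of_nonneg hpos]
    calc |w.im| * (1 - (‖w‖ ^ 2)⁻¹) ≤ ‖w‖ * (1 - (‖w‖ ^ 2)⁻¹) := by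
          gcongr; exact Complex.abs_im_le_norm w
      _ = (‖w‖ - 1) * (1 + ‖w‖⁻¹) := by field_simp; ring
      _ ≤ 1 / n * 2 := mul_le_mul hr (by linarith) (by positivity) (by positivity)
      _ = 2 / n := by ring

lemma volume_reProdIm (s t : Set ℝ) : volume (s ×ℂ t) = volume s * volume t := by
  have : s ×ℂ t = Complex.measurableEquivRealProd ⁻¹' (s ×ˢ t) := rfl
  rw [this, Complex.volume_preserving_equiv_real_prod.measure_preimage_equiv,
    Measure.volume_eq_prod, Measure.prod_prod]

lemma volume_unitLemniscate_chebyshevC_le {n : ℕ} (hn : 1 ≤ n) :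
    volume (unitLemniscate (Chebyshev.C ℂ n)) ≤ ENNReal.ofReal (24 / n) := by
  refine (measure_mono (unitLemniscate_chebyshevC_subset hn)).trans (le_of_eq ?_)
  rw [volume_reProdIm, Real.volume_Icc, Real.volume_Icc, ← ENNReal.ofReal_mul (by norm_num)]
  congr 1
  ring

/-! ### Composition with the Chebyshev polynomials -/

lemma mem_monicWithZerosIn {p : ℂ[X]} (hp : p.Monic) {K : Set ℂ}
    (hK : ∀ z, p.eval z = 0 → z ∈ K) : p ∈ monicWithZerosIn p.natDegree K := by
  have hsp := IsAlgClosed.splits p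
  have hlen : p.roots.toList.length = p.natDegree := by
    rw [Multiset.length_toList, hsp.natDegree_eq_card_roots]
  refine ⟨fun j => p.roots.toList.get (j.cast hlen.symm), fun j => hK _ ?_, ?_⟩
  · exact isRoot_of_mem_roots (Multiset.mem_toList.1 (List.get_mem _ _))
  · conv_lhs => rw [← prod_multiset_X_sub_C_of_monic_of_roots_card_eq hp
      hsp.natDegree_eq_card_roots.symm, ← Multiset.coe_toList p.roots, Multiset.map_coe,
      Multiset.prod_coe]
    rw [← Fin.prod_univ_fun_getElem]
    exact (Fintype.prod_equiv (finCongr hlen) _ _ fun i => rfl)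

lemma minLemniscateArea_mul_le {d : ℕ} (hd : 1 ≤ d) {K : Set ℂ} (hK : IsPeriodSet d K) {n : ℕ}
    (hn : 1 ≤ n) :
    minLemniscateArea (n * d) K ≤ ENNReal.ofReal
      ((((d - 1 : ℕ) : ℝ) * Real.pi + 1 / d) * 24 ^ (1 / (d : ℝ)) *
        (n : ℝ) ^ (-(1 / (d : ℝ)))) := by
  obtain ⟨Q, hQ, rfl, rfl⟩ := hK
  set d := Q.natDegree
  obtain ⟨hCm, hCd⟩ := monic_natDegree_chebyshevC (n - 1)
  rw [Nat.sub_add_cancel hn] at hCm hCd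
  have hmem := mem_monicWithZerosIn (p := (Chebyshev.C ℂ n).comp Q)
    (K := (fun z => Q.eval z) ⁻¹' segmentTwo) (hCm.comp hQ (Nat.one_le_iff_ne_zero.1 hd)) fun z hz =>
      mem_segmentTwo_of_eval_chebyshevC_eq_zero (n := n) (by omega) (by rwa [eval_comp] at hz)
  rw [natDegree_comp, hCd] at hmem
  refine (iInf₂_le _ hmem).trans ?_
  have hpre : unitLemniscate ((Chebyshev.C ℂ n).comp Q) =
      (fun z => Q.eval z) ⁻¹' unitLemniscate (Chebyshev.C ℂ n) := by
    ext z
    simp [unitLemniscate, eval_comp]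
  have hmeas : MeasurableSet (unitLemniscate (Chebyshev.C ℂ n)) :=
    (isOpen_lt (Chebyshev.C ℂ n).continuous.norm continuous_const).measurableSet
  have hnR : (0 : ℝ) < n := by exact_mod_cast hn
  have hdR : (d : ℝ) ≠ 0 := by positivity
  have hpos : (0 : ℝ) < 24 / n := by positivity
  -- `t` is chosen so that `t ^ (2 d) = 24 / n`
  have ht := volume_preimage_eval_le hQ hd hmeas (t := (24 / n : ℝ) ^ (1 / (2 * d : ℝ)))
    (by positivity) (by
      rw [← Real.rpow_mul_natCast hpos.le]
      have : 1 / (2 * d : ℝ) * ((2 * d : ℕ) : ℝ) = 1 := by push_cast; field_simp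
      rw [this, Real.rpow_one]
      exact volume_unitLemniscate_chebyshevC_le hn)
  rw [hpre]
  refine ht.trans (le_of_eq ?_)
  congr 1
  have h2 : 1 / (2 * d : ℝ) * ((2 : ℕ) : ℝ) = 1 / d := by push_cast; field_simp
  rw [← Real.rpow_mul_natCast hpos.le, h2, Real.div_rpow (by norm_num) hnR.le,
    Real.rpow_neg hnR.le, div_eq_mul_inv (_ ^ _), ← mul_assoc]

theorem lemma4p4 (d : ℕ) (hd : 1 ≤ d) :
    ∃ c : ℝ, 0 < c ∧ ∀ K : Set ℂ, IsPeriodSet d K →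
      infLemniscateArea K = 0 ∧
      ∀ n : ℕ, 1 ≤ n →
        minLemniscateArea (n * d) K ≤ ENNReal.ofReal (c * (n : ℝ) ^ (-(1 / (d : ℝ)))) := by
  have hdR : (0 : ℝ) < d := by exact_mod_cast hd
  refine ⟨(((d - 1 : ℕ) : ℝ) * Real.pi + 1 / d) * 24 ^ (1 / (d : ℝ)), by positivity,
    fun K hK => ⟨?_, fun n hn => minLemniscateArea_mul_le hd hK hn⟩⟩
  have hlim := ENNReal.tendsto_ofReal (((tendsto_rpow_neg_atTop (y := 1 / (d : ℝ))
    (by positivity)).comp tendsto_natCast_atTop_atTop).const_mul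
      ((((d - 1 : ℕ) : ℝ) * Real.pi + 1 / d) * 24 ^ (1 / (d : ℝ))))
  rw [mul_zero, ENNReal.ofReal_zero] at hlim
  refine nonpos_iff_eq_zero.1 (ge_of_tendsto hlim ?_)
  filter_upwards [Filter.eventually_ge_atTop 1] with n hn
  exact (iInf₂_le (n * d) (Nat.mul_pos hn hd)).trans (minLemniscateArea_mul_le hd hK hn)
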